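/- Let $N\ge 2$ and let $G=(V,E)$ be a finite simple connected graph with vertex set $V=\{1,\dots,N\}$; let $d_i$ be the degree of the vertex $i$. Let $R_{ij}$ be the effective resistance between $i$ and $j$ when each edge of $G$ is a unit resistor, and let $$R^+(G)=\sum_{i<j}(d_i+d_j)R_{ij}$$ be the additive degree-Kirchhoff index of $G$. Let $P$ be the transition matrix of the simple random walk on $G$, i.e. $P_{vw}=1/d_v$ if $v$ and $w$ are adjacent and $P_{vw}=0$ otherwise. Let $\sigma\ge 0$ be defined by $$\sigma^2=\frac{2}{N}\sum_{\{i,j\}\in E}\frac{1}{d_id_j}.$$ Then $\sigma^2=\operatorname{tr}(P^2)/N$, and $$R^+(G)\;\ge\; N\left[\frac{1}{1+\frac{\sigma}{\sqrt{N-1}}}+\frac{(N-2)^2}{N-1-\frac{\sigma}{\sqrt{N-1}}}\right]+(N-1)^2,$$ where for $N=2$ the second fraction (which is then $0/0$) is read as $0$. -/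

import Mathlib

namespace AddKirchhoff

open Matrix

/-- `v` is a potential (voltage) on the electrical network obtained from `G` by putting a unit
resistor on each edge, when a unit current enters at `i` and leaves at `j`: by Ohm's and Kirchhoff's
laws the net current `∑ y ∼ x, (v x - v y)` out of each vertex `x` is `1` at `i`, `-1` at `j`
and `0` elsewhere (and identically `0` if `i = j`). -/
def IsUnitPotential {V : Type*} [Fintype V] [DecidableEq V] (G : SimpleGraph V)
    [DecidableRel G.Adj] (i j : V) (v : V → ℝ) : Prop :=
  ∀ x : V, ∑ y ∈ G.neighborFinset x, (v x - v y)
    = (if x = i then (1 : ℝ) else 0) - (if x = j then (1 : ℝ) else 0)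

open Classical in
/-- The effective resistance between `i` and `j`: the potential difference produced by a unit
current from `i` to `j`. For a connected graph the potential exists and the difference does not
depend on its choice, see `effResistance_eq` and `exists_isUnitPotential`. -/
noncomputable def effResistance {V : Type*} [Fintype V] [DecidableEq V] (G : SimpleGraph V)
    [DecidableRel G.Adj] (i j : V) : ℝ :=
  if h : ∃ v : V → ℝ, IsUnitPotential G i j v then h.choose i - h.choose j else 0

theorem isUnitPotential_iff {V : Type*} [Fintype V] [DecidableEq V] (G : SimpleGraph V)
    [DecidableRel G.Adj] (i j : V) (v : V → ℝ) :
    IsUnitPotential G i j v ↔ G.lapMatrix ℝ *ᵥ v = Pi.single i 1 - Pi.single j 1 := by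
  rw [funext_iff]
  refine forall_congr' fun x => ?_
  simp [SimpleGraph.lapMatrix_mulVec_apply, Finset.sum_sub_distrib, Pi.single_apply]

/-- On a connected graph a potential for a unit current exists. -/
theorem exists_isUnitPotential {V : Type*} [Fintype V] [DecidableEq V] (G : SimpleGraph V)
    [DecidableRel G.Adj] (hG : G.Connected) (i j : V) :
    ∃ v : V → ℝ, IsUnitPotential G i j v := by
  haveI := hG.nonempty
  have hcard : (0 : ℝ) < Fintype.card V := by exact_mod_cast Fintype.card_pos
  have hcol : ∀ v : V → ℝ, ∑ x, (G.lapMatrix ℝ *ᵥ v) x = 0 := fun v => by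
    have h1 : ∑ x, (G.lapMatrix ℝ *ᵥ v) x = (fun _ => (1 : ℝ)) ⬝ᵥ (G.lapMatrix ℝ *ᵥ v) := by
      simp [dotProduct]
    rw [h1, dotProduct_mulVec, ← mulVec_transpose, (G.isSymm_lapMatrix (R := ℝ)).eq,
      SimpleGraph.lapMatrix_mulVec_const_eq_zero]
    simp
  let f : (V → ℝ) →ₗ[ℝ] (V → ℝ) :=
    (G.lapMatrix ℝ).mulVecLin + LinearMap.pi fun _ => ∑ x, LinearMap.proj x
  have hf : ∀ v x, f v x = (G.lapMatrix ℝ *ᵥ v) x + ∑ y, v y := fun v x => by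
    simp [f]
  have hsum : ∀ v, ∑ x, f v x = Fintype.card V * ∑ y, v y := fun v => by
    simp only [hf, Finset.sum_add_distrib, hcol]
    simp
  have hinj : Function.Injective f := by
    rw [injective_iff_map_eq_zero]
    intro v hv
    have hs : ∑ y, v y = 0 := by
      have := hsum v
      rw [hv] at this
      simpa [hcard.ne'] using this
    have hL : G.lapMatrix ℝ *ᵥ v = 0 := by
      ext x
      have := hf v x
      rw [hv, hs] at this
      simpa using this.symm
    rw [SimpleGraph.lapMatrix_mulVec_eq_zero_iff_forall_reachable] at hL
    ext x
    have : ∑ y, v y = Fintype.card V * v x := by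
      rw [Finset.sum_congr rfl fun y _ => hL y x (hG.preconnected y x)]
      simp
    rw [hs] at this
    simpa [hcard.ne'] using this.symm
  obtain ⟨v, hv⟩ := (LinearMap.injective_iff_surjective.mp hinj) (Pi.single i 1 - Pi.single j 1)
  refine ⟨v, (isUnitPotential_iff G i j v).mpr ?_⟩
  have hs : ∑ y, v y = 0 := by
    have := hsum v
    rw [hv] at this
    simpa [hcard.ne', Finset.sum_sub_distrib] using this
  ext x
  have := hf v x
  rw [hv, hs] at this
  simpa using this.symm

/-- On a connected graph the effective resistance is computed by any potential for a unit
current. -/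
theorem effResistance_eq {V : Type*} [Fintype V] [DecidableEq V] (G : SimpleGraph V)
    [DecidableRel G.Adj] (hG : G.Connected) {i j : V} {v : V → ℝ} (hv : IsUnitPotential G i j v) :
    effResistance G i j = v i - v j := by
  have h : ∃ v : V → ℝ, IsUnitPotential G i j v := ⟨v, hv⟩
  have hw := h.choose_spec
  unfold effResistance
  rw [dif_pos h]
  rw [isUnitPotential_iff] at hv hw
  have h0 : G.lapMatrix ℝ *ᵥ (h.choose - v) = 0 := by
    rw [mulVec_sub, hv, hw, sub_self]
  rw [SimpleGraph.lapMatrix_mulVec_eq_zero_iff_forall_reachable] at h0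
  have := h0 i j (hG.preconnected i j)
  simp only [Pi.sub_apply] at this
  linarith

/-- The additive degree-Kirchhoff index `R⁺(G) = ∑_{i<j} (d_i + d_j) R_{ij}`. -/
noncomputable def additiveKirchhoff {N : ℕ} (G : SimpleGraph (Fin N)) [DecidableRel G.Adj] : ℝ :=
  ∑ i : Fin N, ∑ j ∈ Finset.Ioi i, ((G.degree i : ℝ) + G.degree j) * effResistance G i j

/-- The transition matrix of the simple random walk on `G`. -/
noncomputable def transitionMatrix {N : ℕ} (G : SimpleGraph (Fin N)) [DecidableRel G.Adj] :
    Matrix (Fin N) (Fin N) ℝ :=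
  Matrix.of fun v w => if G.Adj v w then 1 / (G.degree v : ℝ) else 0

/-- `(2 / N) ∑_{(i,j) ∈ E} 1 / (d_i d_j)`, each edge being counted once. -/
noncomputable def sigmaSq {N : ℕ} (G : SimpleGraph (Fin N)) [DecidableRel G.Adj] : ℝ :=
  (2 / (N : ℝ)) * ∑ i : Fin N, ∑ j ∈ Finset.Ioi i,
    if G.Adj i j then 1 / ((G.degree i : ℝ) * G.degree j) else 0

/-- The nonnegative number `σ` whose square is `sigmaSq G`. -/
noncomputable def sigma {N : ℕ} (G : SimpleGraph (Fin N)) [DecidableRel G.Adj] : ℝ :=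
  √(sigmaSq G)

end AddKirchhoff

/-! ### Spectrum of the random walk -/

namespace AddKirchhoff

open Matrix

/-! Write λ_k for the walk's eigenvalues, λ_{k₀} = 1, M for `green` and vol = ∑ d_j. Expanding
resistances in the degree-orthonormal eigenfunctions gives R⁺ = vol · ∑ M_ii + N · ∑_{k≠k₀}
1/(1-λ_k) (`sum_degree_mul_effResistance`), and the two terms are bounded separately.

Diagonal term: Cauchy–Schwarz together with P_ii = 0 gives d_i M_ii ≥ (1 - d_i/vol)²
(`sq_le_degree_mul_green_self`); summing over i yields (N-1)² (`sum_green_self_ge`).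

Spectral term (`le_sum_inv`): the N-1 numbers 1-λ_k are positive with sum N. Singling out the least
eigenvalue -s and averaging the others bounds the reciprocal sum by a function increasing for s ≥
1/(N-1). Finally s ≥ σ² ≥ σ/√(N-1), from tr P = 0 and tr P² = Nσ². -/

/-- A symmetric real matrix has a full orthonormal system of eigenvectors. -/
theorem exists_orthonormal_eigenvectors {V : Type*} [Fintype V] [DecidableEq V]
    {S : Matrix V V ℝ} (hS : S.IsHermitian) :
    ∃ (lam : V → ℝ) (f : V → V → ℝ),
      (∀ k, S *ᵥ f k = lam k • f k) ∧
      (∀ k l, ∑ x, f k x * f l x = if k = l then 1 else 0) ∧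
      (∀ x y, ∑ k, f k x * f k y = if x = y then 1 else 0) := by
  refine ⟨hS.eigenvalues, fun k => (hS.eigenvectorBasis k).ofLp,
    hS.mulVec_eigenvectorBasis, fun k l => ?_, fun x y => ?_⟩
  · have := orthonormal_iff_ite.mp hS.eigenvectorBasis.orthonormal k l
    rw [← this]
    simp [PiLp.inner_apply, mul_comm]
  · have := hS.eigenvectorBasis.sum_inner_mul_inner (EuclideanSpace.single x (1 : ℝ))
      (EuclideanSpace.single y (1 : ℝ))
    simpa [EuclideanSpace.inner_single_left, EuclideanSpace.inner_single_right,
      Pi.single_apply, eq_comm] using this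

/-- Eigenvalues and eigenfunctions of the random walk on `G`; the eigenfunctions are orthonormal
with respect to the degree weights. -/
structure WalkEigenbasis {V : Type*} [Fintype V] [DecidableEq V] (G : SimpleGraph V)
    [DecidableRel G.Adj] where
  /-- the eigenvalues -/
  lam : V → ℝ
  /-- the eigenfunctions -/
  g : V → V → ℝ
  sum_neighbor : ∀ k x, ∑ y ∈ G.neighborFinset x, g k y = lam k * (G.degree x * g k x)
  orthonormal : ∀ k l, ∑ x, (G.degree x : ℝ) * (g k x * g l x) = if k = l then 1 else 0
  complete : ∀ x y, ∑ k, g k x * g k y = if x = y then 1 / (G.degree x : ℝ) else 0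

/-- P is similar to the symmetric matrix with entries 1/√(d_x d_y) on edges; dividing its
eigenvectors by √d_x gives the eigenfunctions. -/
theorem exists_walkEigenbasis {V : Type*} [Fintype V] [DecidableEq V] (G : SimpleGraph V)
    [DecidableRel G.Adj] (hd : ∀ x, 0 < G.degree x) : Nonempty (WalkEigenbasis G) := by
  have hd' : ∀ x, (0 : ℝ) < G.degree x := fun x => by exact_mod_cast hd x
  set r : V → ℝ := fun x => √(G.degree x) with hr
  have hr0 : ∀ x, r x ≠ 0 := fun x => (Real.sqrt_pos.mpr (hd' x)).ne'
  have hr2 : ∀ x, (G.degree x : ℝ) = r x * r x := fun x =>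
    (Real.mul_self_sqrt (hd' x).le).symm
  let S : Matrix V V ℝ := Matrix.of fun x y => if G.Adj x y then 1 / (r x * r y) else 0
  have hS : S.IsHermitian := by
    ext x y
    simp [S, G.adj_comm, mul_comm]
  obtain ⟨lam, f, h1, h2, h3⟩ := exists_orthonormal_eigenvectors hS
  refine ⟨⟨lam, fun k x => f k x / r x, fun k x => ?_, fun k l => ?_, fun x y => ?_⟩⟩
  · have h := congrFun (h1 k) x
    simp only [mulVec, dotProduct, S, of_apply, Pi.smul_apply, smul_eq_mul] at h
    have : ∑ y ∈ G.neighborFinset x, f k y / r y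
        = r x * ∑ y, (if G.Adj x y then 1 / (r x * r y) else 0) * f k y := by
      rw [Finset.mul_sum, SimpleGraph.neighborFinset_eq_filter, Finset.sum_filter]
      refine Finset.sum_congr rfl fun y _ => ?_
      have := hr0 x
      have := hr0 y
      split_ifs
      · field_simp
      · simp
    rw [this, h, hr2]
    have := hr0 x
    field_simp
  · rw [← h2]
    refine Finset.sum_congr rfl fun x _ => ?_
    have := hr0 x
    rw [hr2]
    field_simp
  · have : ∑ k, f k x / r x * (f k y / r y) = (∑ k, f k x * f k y) / (r x * r y) := by
      rw [Finset.sum_div]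
      exact Finset.sum_congr rfl fun k _ => by rw [div_mul_div_comm]
    rw [this, h3]
    split_ifs with h
    · rw [h, hr2]
    · simp

namespace WalkEigenbasis

variable {V : Type*} [Fintype V] [DecidableEq V] {G : SimpleGraph V} [DecidableRel G.Adj]

theorem lam_eq_sum (b : WalkEigenbasis G) (k : V) :
    b.lam k = ∑ x, ∑ y ∈ G.neighborFinset x, b.g k x * b.g k y := by
  have h := b.orthonormal k k
  rw [if_pos rfl] at h
  simp_rw [← Finset.mul_sum, b.sum_neighbor]
  conv_lhs => rw [← mul_one (b.lam k), ← h, Finset.mul_sum]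
  exact Finset.sum_congr rfl fun x _ => by ring

/-- This is tr P = 0: the graph has no loops, so completeness is only used off the diagonal. -/
theorem sum_lam (b : WalkEigenbasis G) : ∑ k, b.lam k = 0 := by
  simp_rw [b.lam_eq_sum]
  rw [Finset.sum_comm]
  refine Finset.sum_eq_zero fun x _ => ?_
  rw [Finset.sum_comm]
  refine Finset.sum_eq_zero fun y hy => ?_
  rw [b.complete, if_neg]
  rintro rfl
  simp at hy

theorem sum_lam_sq (b : WalkEigenbasis G) (hd : ∀ x, 0 < G.degree x) :
    ∑ k, b.lam k ^ 2
      = ∑ x, ∑ y ∈ G.neighborFinset x, 1 / ((G.degree x : ℝ) * G.degree y) := by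
  have h (k : V) : b.lam k ^ 2
      = ∑ x, 1 / (G.degree x : ℝ) * ∑ y ∈ G.neighborFinset x, ∑ z ∈ G.neighborFinset x,
        b.g k y * b.g k z := by
    have h := b.orthonormal k k
    rw [if_pos rfl] at h
    simp_rw [← Finset.sum_mul_sum, b.sum_neighbor]
    rw [← mul_one (b.lam k ^ 2), ← h, Finset.mul_sum]
    refine Finset.sum_congr rfl fun x _ => ?_
    have : (G.degree x : ℝ) ≠ 0 := by exact_mod_cast (hd x).ne'
    rw [h]
    field_simp
  simp_rw [h]
  rw [Finset.sum_comm]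
  refine Finset.sum_congr rfl fun x _ => ?_
  rw [← Finset.mul_sum, Finset.sum_comm, Finset.mul_sum]
  refine Finset.sum_congr rfl fun y hy => ?_
  rw [Finset.sum_comm]
  simp_rw [b.complete]
  rw [Finset.sum_ite_eq, if_pos hy]
  ring

theorem lapMatrix_mulVec (b : WalkEigenbasis G) (k : V) (x : V) :
    (G.lapMatrix ℝ *ᵥ b.g k) x = (1 - b.lam k) * (G.degree x * b.g k x) := by
  rw [SimpleGraph.lapMatrix_mulVec_apply, b.sum_neighbor]
  ring

theorem lam_le_one (b : WalkEigenbasis G) (k : V) : b.lam k ≤ 1 := by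
  have h := (G.posSemidef_lapMatrix ℝ).dotProduct_mulVec_nonneg (b.g k)
  have h1 := b.orthonormal k k
  rw [if_pos rfl] at h1
  have : star (b.g k) ⬝ᵥ (G.lapMatrix ℝ *ᵥ b.g k) = 1 - b.lam k := by
    simp only [dotProduct, b.lapMatrix_mulVec, star_trivial]
    conv_rhs => rw [← mul_one (1 - b.lam k), ← h1, Finset.mul_sum]
    rw [h1]
    exact Finset.sum_congr rfl fun x _ => by ring
  linarith

/-- The Laplacian has zero column sums, so an eigenfunction with λ ≠ 1 is degree-orthogonal to the
constants; by completeness not all of them can be. -/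
theorem exists_lam_eq_one (b : WalkEigenbasis G) [Nonempty V] (hd : ∀ x, 0 < G.degree x) :
    ∃ k, b.lam k = 1 := by
  by_contra! hne
  have h0 (k : V) : ∑ x, (G.degree x : ℝ) * b.g k x = 0 := by
    have h : (1 - b.lam k) * ∑ x, (G.degree x : ℝ) * b.g k x = 0 := by
      rw [Finset.mul_sum]
      simp_rw [← b.lapMatrix_mulVec]
      have h1 : ∑ x, (G.lapMatrix ℝ *ᵥ b.g k) x
          = (fun _ => (1 : ℝ)) ⬝ᵥ (G.lapMatrix ℝ *ᵥ b.g k) := by simp [dotProduct]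
      rw [h1, dotProduct_mulVec, ← mulVec_transpose, (G.isSymm_lapMatrix (R := ℝ)).eq,
        SimpleGraph.lapMatrix_mulVec_const_eq_zero]
      simp
    exact (mul_eq_zero.mp h).resolve_left (sub_ne_zero.mpr (hne k).symm)
  obtain ⟨y⟩ := ‹Nonempty V›
  have h : ∑ k, b.g k y * ∑ x, (G.degree x : ℝ) * b.g k x = 1 := by
    simp_rw [Finset.mul_sum]
    rw [Finset.sum_comm]
    have (x : V) : ∑ k, b.g k y * ((G.degree x : ℝ) * b.g k x) = if y = x then 1 else 0 := by
      have : ∑ k, b.g k y * ((G.degree x : ℝ) * b.g k x)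
          = G.degree x * ∑ k, b.g k y * b.g k x := by
        rw [Finset.mul_sum]
        exact Finset.sum_congr rfl fun k _ => by ring
      rw [this, b.complete]
      split_ifs with hxy
      · subst hxy
        have : (G.degree y : ℝ) ≠ 0 := by exact_mod_cast (hd y).ne'
        field_simp
      · simp
    simp [this]
  simp [h0] at h

theorem g_eq_of_lam_eq_one (b : WalkEigenbasis G) (hG : G.Connected) {k : V}
    (hk : b.lam k = 1) (x y : V) : b.g k x = b.g k y := by
  have h : G.lapMatrix ℝ *ᵥ b.g k = 0 := by
    ext x
    rw [b.lapMatrix_mulVec, hk]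
    simp
  rw [SimpleGraph.lapMatrix_mulVec_eq_zero_iff_forall_reachable] at h
  exact h x y (hG.preconnected x y)

theorem sum_degree_mul_sq (b : WalkEigenbasis G) (hG : G.Connected) {k : V}
    (hk : b.lam k = 1) (x : V) : (∑ y, (G.degree y : ℝ)) * b.g k x ^ 2 = 1 := by
  have h := b.orthonormal k k
  rw [if_pos rfl] at h
  rw [← h, Finset.sum_mul]
  refine Finset.sum_congr rfl fun y _ => ?_
  rw [b.g_eq_of_lam_eq_one hG hk x y]
  ring

/-- Both eigenfunctions are nonzero constants, hence not orthogonal. -/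
theorem eq_of_lam_eq_one (b : WalkEigenbasis G) (hG : G.Connected) {k l : V}
    (hk : b.lam k = 1) (hl : b.lam l = 1) : k = l := by
  by_contra hne
  have h := b.orthonormal k l
  rw [if_neg hne] at h
  have h1 := b.sum_degree_mul_sq hG hk k
  have h2 := b.sum_degree_mul_sq hG hl k
  have h3 : (∑ y, (G.degree y : ℝ)) * (b.g k k * b.g l k) = 0 := by
    rw [← h, Finset.sum_mul]
    refine Finset.sum_congr rfl fun y _ => ?_
    rw [b.g_eq_of_lam_eq_one hG hk k y, b.g_eq_of_lam_eq_one hG hl k y]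
  have h4 : (1 : ℝ) = ((∑ y, (G.degree y : ℝ)) * (b.g k k * b.g l k)) ^ 2 := by
    linear_combination -h1 - (∑ y, (G.degree y : ℝ)) * b.g k k ^ 2 * h2
  rw [h3] at h4
  norm_num at h4

end WalkEigenbasis

/-! ### σ² as a trace -/

theorem sum_sum_Ioi_of_symm {N : ℕ} (F : Fin N → Fin N → ℝ) (h0 : ∀ i, F i i = 0)
    (hs : ∀ i j, F i j = F j i) :
    ∑ i, ∑ j, F i j = 2 * ∑ i, ∑ j ∈ Finset.Ioi i, F i j := by
  have h := Finset.sum_sum_Ioi_add_eq_sum_sum_off_diag F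
  have h1 (i : Fin N) : ∑ j ∈ {i}ᶜ, F j i = ∑ j, F i j := by
    rw [Finset.sum_congr rfl fun j _ => hs j i, ← Finset.sum_add_sum_compl {i} (F i)]
    simp [h0]
  simp_rw [h1] at h
  rw [← h, Finset.mul_sum]
  refine Finset.sum_congr rfl fun i _ => ?_
  rw [Finset.mul_sum]
  exact Finset.sum_congr rfl fun j _ => by rw [hs j i]; ring

theorem sigmaSq_eq {N : ℕ} (G : SimpleGraph (Fin N)) [DecidableRel G.Adj] :
    sigmaSq G = (∑ x, ∑ y ∈ G.neighborFinset x, 1 / ((G.degree x : ℝ) * G.degree y)) / N := by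
  have h := sum_sum_Ioi_of_symm
    (fun i j => if G.Adj i j then 1 / ((G.degree i : ℝ) * G.degree j) else 0)
    (by simp) (fun i j => by simp [G.adj_comm, mul_comm])
  simp_rw [SimpleGraph.neighborFinset_eq_filter, Finset.sum_filter]
  rw [h, sigmaSq]
  ring

theorem sigmaSq_nonneg {N : ℕ} (G : SimpleGraph (Fin N)) [DecidableRel G.Adj] :
    0 ≤ sigmaSq G := by
  rw [sigmaSq_eq]
  positivity

theorem trace_transitionMatrix_sq {N : ℕ} (G : SimpleGraph (Fin N)) [DecidableRel G.Adj] :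
    (transitionMatrix G ^ 2).trace
      = ∑ x, ∑ y ∈ G.neighborFinset x, 1 / ((G.degree x : ℝ) * G.degree y) := by
  simp_rw [SimpleGraph.neighborFinset_eq_filter, Finset.sum_filter]
  simp only [sq, Matrix.trace, Matrix.diag_apply, Matrix.mul_apply, transitionMatrix,
    Matrix.of_apply]
  refine Finset.sum_congr rfl fun x _ => Finset.sum_congr rfl fun y _ => ?_
  by_cases h : G.Adj x y
  · simp [h, h.symm, mul_comm]
  · simp [h]

/-! ### Reciprocal sums -/

/-- If `n - 1` positive numbers add up to `n`, and `1 + s` is one of them, then their reciprocals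
add up to at least the value obtained when the others are equal. -/
theorem le_sum_inv_of_mem {ι : Type*} [DecidableEq ι] {A : Finset ι} {x : ι → ℝ}
    (hx : ∀ k ∈ A, 0 < x k) {k₁ : ι} (hk₁ : k₁ ∈ A) {n : ℝ} (hcard : (A.card : ℝ) = n - 1)
    (hsum : ∑ k ∈ A, x k = n) :
    1 / x k₁ + (n - 2) ^ 2 / (n - x k₁) ≤ ∑ k ∈ A, 1 / x k := by
  rw [← Finset.add_sum_erase A _ hk₁] at hsum ⊢
  have h := Finset.sq_sum_div_le_sum_sq_div (A.erase k₁) (fun _ => (1 : ℝ)) (g := x)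
    fun i hi => hx i (Finset.mem_of_mem_erase hi)
  have hc : ((A.erase k₁).card : ℝ) = n - 2 := by
    have := Finset.card_erase_add_one hk₁
    have : ((A.erase k₁).card : ℝ) + 1 = A.card := by exact_mod_cast this
    linarith
  simp only [Finset.sum_const, nsmul_eq_mul, mul_one, one_pow, hc] at h
  have : ∑ k ∈ A.erase k₁, x k = n - x k₁ := by linarith
  rw [this] at h
  linarith

theorem reciprocal_bound_mono {n s t : ℝ} (hn : 3 ≤ n) (ht : 1 ≤ (n - 1) * t) (hts : t ≤ s)
    (hs : s < n - 1) :
    1 / (1 + t) + (n - 2) ^ 2 / (n - 1 - t) ≤ 1 / (1 + s) + (n - 2) ^ 2 / (n - 1 - s) := by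
  have ht0 : 0 < t := by
    by_contra! h
    nlinarith
  have hs1 : 1 ≤ (n - 1) * s := ht.trans (by gcongr; linarith)
  have e1 : 0 < 1 + t := by linarith
  have e2 : 0 < 1 + s := by linarith
  have e3 : 0 < n - 1 - t := by linarith
  have e4 : 0 < n - 1 - s := by linarith
  -- Factorwise: (n-2)(1+s) - (n-1-s) = (n-1)s - 1 ≥ 0, and likewise for t.
  have key : (n - 1 - s) * (n - 1 - t) ≤ ((n - 2) * (1 + s)) * ((n - 2) * (1 + t)) := by
    refine mul_le_mul (by linarith) (by linarith) e3.le ?_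
    exact mul_nonneg (by linarith) e2.le
  rw [← sub_nonneg]
  have : 1 / (1 + s) + (n - 2) ^ 2 / (n - 1 - s) - (1 / (1 + t) + (n - 2) ^ 2 / (n - 1 - t))
      = (s - t) * (((n - 2) * (1 + s)) * ((n - 2) * (1 + t)) - (n - 1 - s) * (n - 1 - t))
        / ((1 + s) * (1 + t) * (n - 1 - s) * (n - 1 - t)) := by
    field_simp
    ring
  rw [this]
  apply div_nonneg
  · exact mul_nonneg (by linarith) (by linarith)
  · positivity
-- Green function and effective resistance
namespace WalkEigenbasis

variable {V : Type*} [Fintype V] [DecidableEq V] {G : SimpleGraph V} [DecidableRel G.Adj]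

/-- The sum of `g k x * g k y / (1 - lam k)` over all `k ≠ k₀`: a generalized inverse of the
Laplacian when `k₀` is the index of the eigenvalue `1`. -/
noncomputable def green (b : WalkEigenbasis G) (k₀ x y : V) : ℝ :=
  ∑ k ∈ Finset.univ.erase k₀, b.g k x * b.g k y / (1 - b.lam k)

theorem green_comm (b : WalkEigenbasis G) (k₀ x y : V) : b.green k₀ x y = b.green k₀ y x :=
  Finset.sum_congr rfl fun k _ => by rw [mul_comm (b.g k x)]

theorem lam_lt_one (b : WalkEigenbasis G) (hG : G.Connected) {k₀ k : V}
    (hk₀ : b.lam k₀ = 1) (hk : k ≠ k₀) : b.lam k < 1 :=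
  lt_of_le_of_ne (b.lam_le_one k) fun h => hk (b.eq_of_lam_eq_one hG h hk₀)

/-- The factor 1 - λ_k produced by the Laplacian cancels the denominator, and completeness leaves
the point mass minus the missing k₀ term. That term does not depend on i, so it drops out for a unit
current between two vertices. -/
theorem sum_green_mul (b : WalkEigenbasis G) (hG : G.Connected) (hd : ∀ x, 0 < G.degree x)
    {k₀ : V} (hk₀ : b.lam k₀ = 1) (x i : V) :
    ∑ y ∈ G.neighborFinset x, (b.green k₀ x i - b.green k₀ y i)
      = (if x = i then 1 else 0) - G.degree x * b.g k₀ i ^ 2 := by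
  have h1 : ∑ y ∈ G.neighborFinset x, (b.green k₀ x i - b.green k₀ y i)
      = ∑ k ∈ Finset.univ.erase k₀, (G.degree x : ℝ) * (b.g k x * b.g k i) := by
    simp_rw [green, ← Finset.sum_sub_distrib]
    rw [Finset.sum_comm]
    refine Finset.sum_congr rfl fun k hk => ?_
    have hlt := b.lam_lt_one hG hk₀ (Finset.ne_of_mem_erase hk)
    have hne : 1 - b.lam k ≠ 0 := by linarith
    have h := b.lapMatrix_mulVec k x
    rw [SimpleGraph.lapMatrix_mulVec_apply] at h
    have h2 : ∑ y ∈ G.neighborFinset x,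
          (b.g k x * b.g k i / (1 - b.lam k) - b.g k y * b.g k i / (1 - b.lam k))
        = (G.degree x * b.g k x - ∑ y ∈ G.neighborFinset x, b.g k y)
          * (b.g k i / (1 - b.lam k)) := by
      rw [Finset.sum_sub_distrib, Finset.sum_const, SimpleGraph.card_neighborFinset_eq_degree,
        nsmul_eq_mul, sub_mul, Finset.sum_mul]
      congr 1
      · ring
      · exact Finset.sum_congr rfl fun y _ => by ring
    rw [h2, h]
    field_simp
  have h3 := Finset.add_sum_erase Finset.univ (fun k => b.g k x * b.g k i) (Finset.mem_univ k₀)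
  rw [b.complete] at h3
  have hdx : (G.degree x : ℝ) ≠ 0 := by exact_mod_cast (hd x).ne'
  rw [h1, ← Finset.mul_sum, eq_sub_of_add_eq' h3, b.g_eq_of_lam_eq_one hG hk₀ x i]
  split_ifs
  · field_simp
  · ring

theorem effResistance_eq_green (b : WalkEigenbasis G) (hG : G.Connected)
    (hd : ∀ x, 0 < G.degree x) {k₀ : V} (hk₀ : b.lam k₀ = 1) (i j : V) :
    effResistance G i j = b.green k₀ i i + b.green k₀ j j - 2 * b.green k₀ i j := by
  have hv : IsUnitPotential G i j (fun x => b.green k₀ x i - b.green k₀ x j) := by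
    intro x
    have h1 := b.sum_green_mul hG hd hk₀ x i
    have h2 := b.sum_green_mul hG hd hk₀ x j
    rw [b.g_eq_of_lam_eq_one hG hk₀ j i] at h2
    have : ∑ y ∈ G.neighborFinset x,
          (b.green k₀ x i - b.green k₀ x j - (b.green k₀ y i - b.green k₀ y j))
        = ∑ y ∈ G.neighborFinset x, (b.green k₀ x i - b.green k₀ y i)
          - ∑ y ∈ G.neighborFinset x, (b.green k₀ x j - b.green k₀ y j) := by
      rw [← Finset.sum_sub_distrib]
      exact Finset.sum_congr rfl fun y _ => by ring
    rw [this, h1, h2]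
    ring
  rw [effResistance_eq G hG hv, b.green_comm k₀ j i]
  ring

theorem sum_degree_mul_green (b : WalkEigenbasis G) (hG : G.Connected) {k₀ : V}
    (hk₀ : b.lam k₀ = 1) (i : V) : ∑ j, (G.degree j : ℝ) * b.green k₀ i j = 0 := by
  simp_rw [green, Finset.mul_sum]
  rw [Finset.sum_comm]
  refine Finset.sum_eq_zero fun k hk => ?_
  have h := b.orthonormal k k₀
  rw [if_neg (Finset.ne_of_mem_erase hk)] at h
  have hc : b.g k₀ i ≠ 0 := by
    intro h0
    have := b.sum_degree_mul_sq hG hk₀ i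
    simp [h0] at this
  have h2 : ∑ j, (G.degree j : ℝ) * (b.g k i * b.g k j / (1 - b.lam k))
      = (∑ j, (G.degree j : ℝ) * (b.g k j * b.g k₀ j))
        * (b.g k i / (1 - b.lam k) / b.g k₀ i) := by
    rw [Finset.sum_mul]
    refine Finset.sum_congr rfl fun j _ => ?_
    rw [b.g_eq_of_lam_eq_one hG hk₀ j i]
    field_simp
  rw [h2, h, zero_mul]

theorem sum_degree_mul_green_self (b : WalkEigenbasis G) (k₀ : V) :
    ∑ j, (G.degree j : ℝ) * b.green k₀ j j
      = ∑ k ∈ Finset.univ.erase k₀, 1 / (1 - b.lam k) := by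
  simp_rw [green, Finset.mul_sum]
  rw [Finset.sum_comm]
  refine Finset.sum_congr rfl fun k _ => ?_
  have h := b.orthonormal k k
  rw [if_pos rfl] at h
  rw [← h, Finset.sum_div, h]
  exact Finset.sum_congr rfl fun j _ => by ring

/-- The sum `∑ j, d_j R_{ij}` in terms of the spectrum and the diagonal of `green`. -/
theorem sum_degree_mul_effResistance (b : WalkEigenbasis G) (hG : G.Connected)
    (hd : ∀ x, 0 < G.degree x) {k₀ : V} (hk₀ : b.lam k₀ = 1) (i : V) :
    ∑ j, (G.degree j : ℝ) * effResistance G i j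
      = (∑ j, (G.degree j : ℝ)) * b.green k₀ i i
        + ∑ k ∈ Finset.univ.erase k₀, 1 / (1 - b.lam k) := by
  have h := b.sum_degree_mul_green hG hk₀ i
  have hj (j : V) : (G.degree j : ℝ) * effResistance G i j = G.degree j * b.green k₀ i i
      + G.degree j * b.green k₀ j j - 2 * (G.degree j * b.green k₀ i j) := by
    rw [b.effResistance_eq_green hG hd hk₀]
    ring
  simp_rw [hj]
  rw [Finset.sum_sub_distrib, Finset.sum_add_distrib, ← Finset.mul_sum, h,
    b.sum_degree_mul_green_self, ← Finset.sum_mul, mul_zero, sub_zero]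

/-- The diagonal of `green` is at least `(1 - π)² / d`, where `π` is the stationary probability
and `d` the degree. -/
theorem sq_le_degree_mul_green_self (b : WalkEigenbasis G) (hG : G.Connected)
    (hd : ∀ x, 0 < G.degree x) {k₀ : V} (hk₀ : b.lam k₀ = 1) (i : V) :
    (1 - (G.degree i : ℝ) / ∑ j, (G.degree j : ℝ)) ^ 2 ≤ G.degree i * b.green k₀ i i := by
  set D := (G.degree i : ℝ) with hD
  have hD0 : 0 < D := by rw [hD]; exact_mod_cast hd i
  have hsq := b.sum_degree_mul_sq hG hk₀ i
  set vol := ∑ j, (G.degree j : ℝ)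
  have hvol : vol ≠ 0 := by
    intro h
    simp [h] at hsq
  have h1 := Finset.add_sum_erase Finset.univ (fun k => b.g k i * b.g k i) (Finset.mem_univ k₀)
  rw [b.complete, if_pos rfl, ← hD] at h1
  have h2 : ∑ k ∈ Finset.univ.erase k₀, (1 - b.lam k) * (b.g k i * b.g k i) = 1 / D := by
    have ha : ∑ k, (1 - b.lam k) * (b.g k i * b.g k i) = 1 / D := by
      -- The walk never stays put: this sum is P_ii / d_i.
      have hb : ∑ k, b.lam k * (b.g k i * b.g k i) = 0 := by
        have (k : V) : b.lam k * (b.g k i * b.g k i)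
            = ∑ y ∈ G.neighborFinset i, b.g k i * b.g k y / D := by
          rw [← Finset.sum_div, ← Finset.mul_sum, b.sum_neighbor, ← hD]
          field_simp
        simp_rw [this]
        rw [Finset.sum_comm]
        refine Finset.sum_eq_zero fun y hy => ?_
        rw [← Finset.sum_div, b.complete, if_neg, zero_div]
        rintro rfl
        simp at hy
      simp_rw [sub_mul, one_mul]
      rw [Finset.sum_sub_distrib, hb, b.complete, if_pos rfl, sub_zero]
    rw [← ha, ← Finset.add_sum_erase Finset.univ _ (Finset.mem_univ k₀), hk₀]
    ring
  have hpos : ∀ k ∈ Finset.univ.erase k₀, 0 < 1 - b.lam k := fun k hk => by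
    linarith [b.lam_lt_one hG hk₀ (Finset.ne_of_mem_erase hk)]
  -- Cauchy–Schwarz, splitting g² with the weights 1/(1-λ_k) and 1-λ_k.
  have h3 : (∑ k ∈ Finset.univ.erase k₀, b.g k i * b.g k i) ^ 2
      ≤ b.green k₀ i i * (1 / D) := by
    rw [← h2, green]
    refine Finset.sum_sq_le_sum_mul_sum_of_sq_le_mul _ (fun k hk => ?_) (fun k hk => ?_)
      fun k hk => le_of_eq ?_
    · exact div_nonneg (mul_self_nonneg _) (hpos k hk).le
    · exact mul_nonneg (hpos k hk).le (mul_self_nonneg _)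
    · have := (hpos k hk).ne'
      field_simp
  have h4 : ∑ k ∈ Finset.univ.erase k₀, b.g k i * b.g k i = 1 / D - 1 / vol := by
    rw [eq_sub_of_add_eq' h1, ← sq, eq_div_of_mul_eq hvol ((mul_comm _ _).trans hsq)]
  rw [h4] at h3
  calc (1 - D / vol) ^ 2 = D ^ 2 * (1 / D - 1 / vol) ^ 2 := by field_simp
    _ ≤ D ^ 2 * (b.green k₀ i i * (1 / D)) := by gcongr
    _ = D * b.green k₀ i i := by field_simp

theorem sum_green_self_ge (b : WalkEigenbasis G) (hG : G.Connected)
    (hd : ∀ x, 0 < G.degree x) {k₀ : V} (hk₀ : b.lam k₀ = 1) :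
    ((Fintype.card V : ℝ) - 1) ^ 2
      ≤ ∑ i, (∑ j, (G.degree j : ℝ)) * b.green k₀ i i := by
  have hdeg : ∀ x, (0 : ℝ) < G.degree x := fun x => by exact_mod_cast hd x
  have := hG.nonempty
  set vol := ∑ j, (G.degree j : ℝ) with hvol
  have hv0 : 0 < vol := Finset.sum_pos (fun j _ => hdeg j) Finset.univ_nonempty
  have h1 (i : V) : vol / G.degree i - 2 + G.degree i / vol ≤ vol * b.green k₀ i i := by
    have h := b.sq_le_degree_mul_green_self hG hd hk₀ i
    rw [← hvol] at h
    have hi := hdeg i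
    generalize (G.degree i : ℝ) = D at h hi ⊢
    generalize b.green k₀ i i = M at h ⊢
    clear_value vol
    calc vol / D - 2 + D / vol = vol / D * (1 - D / vol) ^ 2 := by field_simp; ring
      _ ≤ vol / D * (D * M) := by gcongr
      _ = vol * M := by field_simp
  refine le_trans ?_ (Finset.sum_le_sum fun i _ => h1 i)
  rw [Finset.sum_add_distrib, Finset.sum_sub_distrib, ← Finset.sum_div, ← hvol,
    div_self hv0.ne']
  have h2 := Finset.sq_sum_div_le_sum_sq_div Finset.univ (fun _ : V => (1 : ℝ))
    (g := fun i => (G.degree i : ℝ)) fun i _ => hdeg i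
  rw [← hvol] at h2
  have h3 : ∑ i, vol / (G.degree i : ℝ) = vol * ∑ i, (1 : ℝ) ^ 2 / G.degree i := by
    rw [Finset.mul_sum]
    exact Finset.sum_congr rfl fun i _ => by ring
  -- Cauchy–Schwarz again; with -2N and 1 from the other terms this makes (N-1)².
  have h4 : (Fintype.card V : ℝ) ^ 2 ≤ ∑ i, vol / (G.degree i : ℝ) := by
    rw [h3, mul_comm]
    simpa [div_le_iff₀ hv0] using h2
  simp only [Finset.sum_const, Finset.card_univ, nsmul_eq_mul]
  linarith

end WalkEigenbasis

/-! ### Kirchhoff index as a full double sum -/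

theorem effResistance_symm {V : Type*} [Fintype V] [DecidableEq V] (G : SimpleGraph V)
    [DecidableRel G.Adj] (hG : G.Connected) (i j : V) :
    effResistance G i j = effResistance G j i := by
  obtain ⟨v, hv⟩ := exists_isUnitPotential G hG i j
  have hw : IsUnitPotential G j i (-v) := by
    rw [isUnitPotential_iff] at hv ⊢
    rw [Matrix.mulVec_neg, hv, neg_sub]
  rw [effResistance_eq G hG hv, effResistance_eq G hG hw]
  simp only [Pi.neg_apply]
  ring

theorem effResistance_self {V : Type*} [Fintype V] [DecidableEq V] (G : SimpleGraph V)
    [DecidableRel G.Adj] (hG : G.Connected) (i : V) : effResistance G i i = 0 := by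
  obtain ⟨v, hv⟩ := exists_isUnitPotential G hG i i
  rw [effResistance_eq G hG hv, sub_self]

theorem additiveKirchhoff_eq {N : ℕ} (G : SimpleGraph (Fin N)) [DecidableRel G.Adj]
    (hG : G.Connected) :
    additiveKirchhoff G = ∑ i, ∑ j, (G.degree j : ℝ) * effResistance G i j := by
  have h := sum_sum_Ioi_of_symm
    (fun i j => ((G.degree i : ℝ) + G.degree j) * effResistance G i j)
    (fun i => by rw [effResistance_self G hG, mul_zero])
    (fun i j => by rw [effResistance_symm G hG i j, add_comm])
  have h2 : ∑ i, ∑ j, ((G.degree i : ℝ) + G.degree j) * effResistance G i j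
      = 2 * ∑ i, ∑ j, (G.degree j : ℝ) * effResistance G i j := by
    simp_rw [add_mul, Finset.sum_add_distrib]
    rw [Finset.sum_comm, two_mul]
    simp_rw [effResistance_symm G hG]
  rw [additiveKirchhoff]
  linarith

/-! ### Spectral bound -/

/-- The lower bound for the sum of the `1 / (1 - λ)` over the eigenvalues `λ ≠ 1` of the walk. -/
theorem WalkEigenbasis.le_sum_inv {N : ℕ} (hN : 2 ≤ N) {G : SimpleGraph (Fin N)}
    [DecidableRel G.Adj] (hG : G.Connected) (hd : ∀ x, 0 < G.degree x) (b : WalkEigenbasis G)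
    {k₀ : Fin N} (hk₀ : b.lam k₀ = 1) :
    1 / (1 + sigma G / √((N : ℝ) - 1))
        + ((N : ℝ) - 2) ^ 2 / ((N : ℝ) - 1 - sigma G / √((N : ℝ) - 1))
      ≤ ∑ k ∈ Finset.univ.erase k₀, 1 / (1 - b.lam k) := by
  have hN' : (2 : ℝ) ≤ N := by exact_mod_cast hN
  set A := (Finset.univ : Finset (Fin N)).erase k₀ with hA
  have hcardN : A.card + 1 = N := by
    rw [hA, Finset.card_erase_add_one (Finset.mem_univ _)]
    simp
  have hcard : (A.card : ℝ) = N - 1 := by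
    rw [eq_sub_iff_add_eq]
    exact_mod_cast hcardN
  have hpos : ∀ k ∈ A, 0 < 1 - b.lam k := fun k hk => by
    linarith [b.lam_lt_one hG hk₀ (Finset.ne_of_mem_erase hk)]
  have hsumA : ∑ k ∈ A, b.lam k = -1 := by
    have := b.sum_lam
    rw [← Finset.add_sum_erase Finset.univ _ (Finset.mem_univ k₀), hk₀] at this
    linarith
  have hsum : ∑ k ∈ A, (1 - b.lam k) = N := by
    rw [Finset.sum_sub_distrib, hsumA, Finset.sum_const, nsmul_eq_mul, hcard]
    ring
  have hsq : ∑ k, b.lam k ^ 2 = N * sigma G ^ 2 := by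
    rw [sigma, Real.sq_sqrt (sigmaSq_nonneg G), sigmaSq_eq, b.sum_lam_sq hd]
    field_simp
  have hσ0 : 0 ≤ sigma G := Real.sqrt_nonneg _
  set σ := sigma G
  obtain ⟨k₁, hk₁, hmin⟩ := Finset.exists_min_image A b.lam
    (Finset.card_pos.mp (by omega))
  have hle : σ ^ 2 ≤ -b.lam k₁ := by
    -- Every eigenvalue lies in [λ_{k₁}, 1]; expanding, the linear term vanishes because tr P = 0,
    -- leaving N(σ² + λ_{k₁}) ≤ 0.
    have h : ∑ k, (b.lam k - b.lam k₁) * (b.lam k - 1) ≤ 0 := by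
      refine Finset.sum_nonpos fun k _ => mul_nonpos_of_nonneg_of_nonpos ?_ ?_
      · by_cases hk : k = k₀
        · rw [hk, hk₀]
          linarith [b.lam_le_one k₁]
        · linarith [hmin k (Finset.mem_erase.mpr ⟨hk, Finset.mem_univ _⟩)]
      · linarith [b.lam_le_one k]
    have h2 : ∑ k, (b.lam k - b.lam k₁) * (b.lam k - 1)
        = ∑ k, b.lam k ^ 2 - (1 + b.lam k₁) * ∑ k, b.lam k + N * b.lam k₁ := by
      have : (N : ℝ) * b.lam k₁ = ∑ _k : Fin N, b.lam k₁ := by simp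
      rw [this, Finset.mul_sum, ← Finset.sum_sub_distrib, ← Finset.sum_add_distrib]
      exact Finset.sum_congr rfl fun k _ => by ring
    rw [h2, hsq, b.sum_lam] at h
    nlinarith
  -- Cauchy–Schwarz over k ≠ k₀, where ∑ λ_k = -1 and ∑ λ_k² = Nσ² - 1.
  have hge : 1 ≤ (N - 1) * σ ^ 2 := by
    have h := sq_sum_le_card_mul_sum_sq (s := A) (f := b.lam)
    have h2 := Finset.add_sum_erase Finset.univ (fun k => b.lam k ^ 2) (Finset.mem_univ k₀)
    rw [← hA, hsq, hk₀] at h2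
    rw [hsumA, hcard, eq_sub_of_add_eq' h2] at h
    nlinarith
  set q := √((N : ℝ) - 1)
  have hq2 : q ^ 2 = N - 1 := Real.sq_sqrt (by linarith)
  have hq : 0 < q := Real.sqrt_pos.mpr (by linarith)
  have hqσ : 1 ≤ q * σ := by
    rw [← hq2, ← mul_pow] at hge
    exact (one_le_sq_iff₀ (by positivity)).mp hge
  have hts : σ / q ≤ -b.lam k₁ := by
    refine le_trans ?_ hle
    rw [div_le_iff₀ hq]
    nlinarith
  have ht : 1 ≤ ((N : ℝ) - 1) * (σ / q) := by
    rw [← hq2]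
    field_simp
    exact hqσ
  have hmain := le_sum_inv_of_mem hpos hk₁ hcard hsum
  refine le_trans ?_ hmain
  rw [sub_eq_add_neg 1 (b.lam k₁), ← sub_sub (N : ℝ) 1]
  -- For N = 2 the only other eigenvalue is -1 and σ/q = 1, so both second fractions are 0/0 = 0.
  -- For N ≥ 3 a further positive 1 - λ_k keeps the denominators positive.
  rcases hN.eq_or_lt with h2 | h3
  · subst h2
    obtain ⟨a, ha⟩ := Finset.card_eq_one.mp (show A.card = 1 by omega)
    have hk : k₁ = a := by simpa [ha] using hk₁
    rw [ha, Finset.sum_singleton, ← hk] at hsumA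
    rw [hsumA] at hts ⊢
    push_cast at ht ⊢
    have : σ / q = 1 := le_antisymm (by linarith) (by linarith)
    rw [this]
    norm_num
  · have h3' : (3 : ℝ) ≤ N := by exact_mod_cast h3
    refine reciprocal_bound_mono h3' ht hts ?_
    have h4 : 0 < ∑ k ∈ A.erase k₁, (1 - b.lam k) := by
      refine Finset.sum_pos (fun k hk => hpos k (Finset.mem_of_mem_erase hk)) ?_
      rw [← Finset.card_pos, Finset.card_erase_of_mem hk₁]
      omega
    rw [← Finset.add_sum_erase A _ hk₁] at hsum
    linarith

end AddKirchhoff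

/-- For `N = 2` the second fraction has numerator `0` (and denominator `0`); it is read as `0`.
For `3 ≤ N` both denominators are positive. -/
theorem mainTheorem5 (N : ℕ) (hN : 2 ≤ N) (G : SimpleGraph (Fin N)) [DecidableRel G.Adj]
    (hG : G.Connected) :
    AddKirchhoff.sigma G ^ 2 = AddKirchhoff.sigmaSq G ∧
    AddKirchhoff.sigma G ^ 2
      = (AddKirchhoff.transitionMatrix G ^ 2).trace / (N : ℝ) ∧
    AddKirchhoff.additiveKirchhoff G ≥
      (N : ℝ) * (1 / (1 + AddKirchhoff.sigma G / √((N : ℝ) - 1))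
        + ((N : ℝ) - 2) ^ 2 / ((N : ℝ) - 1 - AddKirchhoff.sigma G / √((N : ℝ) - 1)))
      + ((N : ℝ) - 1) ^ 2 := by
  have hσ : AddKirchhoff.sigma G ^ 2 = AddKirchhoff.sigmaSq G :=
    Real.sq_sqrt (AddKirchhoff.sigmaSq_nonneg G)
  refine ⟨hσ, ?_, ?_⟩
  · rw [hσ, AddKirchhoff.sigmaSq_eq, AddKirchhoff.trace_transitionMatrix_sq]
  · have : Nontrivial (Fin N) := Fin.nontrivial_iff_two_le.mpr hN
    have hd : ∀ x, 0 < G.degree x := fun x => hG.preconnected.degree_pos_of_nontrivial x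
    have := hG.nonempty
    obtain ⟨b⟩ := AddKirchhoff.exists_walkEigenbasis G hd
    obtain ⟨k₀, hk₀⟩ := b.exists_lam_eq_one hd
    have h1 := b.sum_green_self_ge hG hd hk₀
    have h2 := b.le_sum_inv hN hG hd hk₀
    rw [AddKirchhoff.additiveKirchhoff_eq G hG]
    simp_rw [b.sum_degree_mul_effResistance hG hd hk₀]
    rw [Finset.sum_add_distrib, Finset.sum_const, Finset.card_univ, nsmul_eq_mul]
    rw [Fintype.card_fin] at h1 ⊢
    rw [add_comm, ge_iff_le]
    gcongr
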